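/- **Setting.** A probabilistic program is given by its control flow graph: a finite set $L$ of labels, a terminal label $\bot\notin L$, a finite set $X$ of real program variables and a finite set $R$ of real sampling variables. Write $L_\bot=L\cup\{\bot\}$. Each sampling variable $r$ has a probability distribution on $\mathbb R$ and a non-empty bounded interval $\mathrm{Supp}_r$ of probability one. Each $\ell\in L$ is of one of four kinds: *demonic* (a non-empty finite set of transitions to targets $\ell'\in L_\bot$); *probabilistic* (finitely many transitions with probabilities in $(0,1)$ summing to $1$); *branching* (finitely many transitions guarded by propositional polynomial predicates over $X$, i.e. Boolean combinations of polynomial inequalities, exactly one of which holds at each $\mathbf x\in\mathbb R^{X}$); *assignment* (a single transition to some $\ell'$ with a measurable update function $f:\mathbb R^X\times\mathbb R^R\to\mathbb R^X$). A configuration is a pair $(\ell,\mathbf x)\in L_\bot\times\mathbb R^X$. From a configuration $(\ell,\mathbf x)$ with $\ell\neq\bot$ the program moves to $(\ell',\mathbf x)$, where $\ell'$ is selected by the scheduler (demonic), drawn with the given probabilities (probabilistic), or is the target whose guard holds at $\mathbf x$ (branching), or it moves to $(\ell',f(\mathbf x,\mathbf r))$ with $\mathbf r$ a fresh sample of independent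 sampling variables (assignment); configurations $(\bot,\mathbf x)$ are absorbing. A (measurable) scheduler $\sigma$ selects a transition after each finite sequence of configurations that ends in a demonic label. With an initial configuration $(\ell_0,\mathbf x_0)$ it induces a probability measure $\mathbb P^\sigma$ on runs $((\ell_n,\mathbf x_n))_{n\ge0}$. Let $T_P=\min\{n\ge 0:\ell_n=\bot\}\in\mathbb N_0\cup\{\infty\}$ be the termination time. Let $I$ be a polynomial invariant: it assigns to each $\ell\in L_\bot$ a propositional polynomial predicate $I(\ell)$ such that $\mathbf x\models I(\ell)$ for every configuration $(\ell,\mathbf x)$ that is reachable from $(\ell_0,\mathbf x_0)$ along a finite path, with sampled values in the sets $\mathrm{Supp}_r$. For $\eta:L_\bot\times\mathbb R^X\to\mathbb R$, the pre-expectation $\mathrm{pre}_\eta(\ell,\mathbf x)$ is: $\max_{\ell'}\eta(\ell',\mathbf x)$ over the targets $\ell'$ if $\ell$ is demonic; $\sum z\,\eta(\ell',\mathbf x)$ over the transitions with probability $z$ and target $\ell'$ if $\ell$ is probabilistic; $\eta(\ell',\mathbf x)$ for the target $\ell'$ whose guard holds at $\mathbf x$ if $\ell$ is branching; $\mathbb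 E\,\eta(\ell',f(\mathbf x,\mathbf r))$ over the independent sampling variables $\mathbf r$ if $\ell$ is an assignment label. Let $\mathrm{TERM}(\ell)$ be the disjunction of the guards of the transitions of $\ell$ with target different from $\bot$ if $\ell$ is branching, and *true* otherwise. The map $\eta$ is a $d$-pRSM (polynomial ranking supermartingale map of degree $d$) with constants $\epsilon>0$ and $K\le-\epsilon$ if: each $\eta(\ell,\cdot)$, $\ell\in L_\bot$, is a polynomial of degree at most $d$; $\eta(\ell,\mathbf x)\ge0$ whenever $\ell\ne\bot$ and $\mathbf x\models I(\ell)$; $\eta(\bot,\mathbf x)=K$ for all $\mathbf x$; and $\mathrm{pre}_\eta(\ell,\mathbf x)\le\eta(\ell,\mathbf x)-\epsilon$ whenever $\ell\neq\bot$ and $\mathbf x\models I(\ell)\wedge\mathrm{TERM}(\ell)$. It is difference-bounded with respect to a non-empty interval $[a,b]\subseteq\mathbb R$ if, for every $\ell\in L$, every $\mathbf x\models I(\ell)$ and every transition from $\ell$ to a target $\ell'$, one has $a\le\eta(\ell',\mathbf x')-\eta(\ell,\mathbf x)\le b$, where: if $\ell$ is demonic or probabilistic, $\mathbf x'=\mathbf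 x$; if $\ell$ is branching, $\mathbf x'=\mathbf x$ and the condition is imposed only when the guard of the transition holds at $\mathbf x$; if $\ell$ is an assignment label, $\mathbf x'=f(\mathbf x,\mathbf r)$ and the condition is imposed for all $\mathbf r\in\prod_{r\in R}\mathrm{Supp}_r$. **Theorem.** Let $\eta$ be a $d$-pRSM with constants $\epsilon,K$ that is difference-bounded with respect to $[a,b]$. Then for every scheduler $\sigma$ and every integer $n\ge1$ with $\epsilon(n-1)>\eta(\ell_0,\mathbf x_0)$, $$\mathbb P^\sigma(T_P>n)\le\exp\left(-\frac{2\left(\epsilon(n-1)-\eta(\ell_0,\mathbf x_0)\right)^2}{(n-1)(b-a)^2}\right),$$ where the right-hand side is read as $0$ if $(n-1)(b-a)^2=0$. Consequently, every non-negative integer $M\ge\eta(\ell_0,\mathbf x_0)/\epsilon+2$ is a concentration bound for the termination time: there are constants $c_1\ge0$ and $c_2>0$ such that $\mathbb P^\sigma(T_P>N)\le c_1e^{-c_2N}$ for all integers $N\ge M$ and all schedulers $\sigma$. -/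

import Mathlib

namespace ProbProg

open MeasureTheory ProbabilityTheory

noncomputable section

/-- Comparison symbols `<`, `≤`, `>`, `≥`. -/
inductive Cmp
  | lt | le | gt | ge

/-- The relation on `ℝ` denoted by a comparison symbol. -/
def Cmp.Holds : Cmp → ℝ → ℝ → Prop
  | .lt, s, t => s < t
  | .le, s, t => s ≤ t
  | .gt, s, t => s > t
  | .ge, s, t => s ≥ t

/-- Propositional polynomial predicates over the variables `X`. -/
inductive PolyPred (X : Type*)
  | tru
  | fls
  | atom (g₁ : MvPolynomial X ℝ) (c : Cmp) (g₂ : MvPolynomial X ℝ)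
  | neg (φ : PolyPred X)
  | conj (φ ψ : PolyPred X)
  | disj (φ ψ : PolyPred X)

/-- The satisfaction relation `x ⊨ φ`. -/
def PolyPred.Sat {X : Type*} (x : X → ℝ) : PolyPred X → Prop
  | .tru => True
  | .fls => False
  | .atom g₁ c g₂ => c.Holds (MvPolynomial.eval x g₁) (MvPolynomial.eval x g₂)
  | .neg φ => ¬ φ.Sat x
  | .conj φ ψ => φ.Sat x ∧ ψ.Sat x
  | .disj φ ψ => φ.Sat x ∨ ψ.Sat x

/-- `L` together with the terminal label `⊥`; it carries the discrete σ-algebra. -/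
inductive Loc (L : Type*)
  | term
  | lab (ℓ : L)

instance {L : Type*} : MeasurableSpace (Loc L) := ⊤

instance {L : Type*} : DiscreteMeasurableSpace (Loc L) := ⟨fun _ => trivial⟩

/-- Configurations `(ℓ, x)`: a label (possibly terminal) and a valuation of the program variables. -/
abbrev Config (L X : Type*) := Loc L × (X → ℝ)

/-- The outgoing transitions of one label, according to the kind of the label:
* demonic: a nonempty finite set of targets;
* probabilistic: finitely many targets with probabilities in `(0, 1)` that add up to `1`;
* branching: finitely many guarded targets, exactly one guard being true at each valuation;
* assignment: one target together with a (Borel measurable) update function. -/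
inductive Block (L X R : Type*)
  | demonic (T : Finset (Loc L)) (hT : T.Nonempty)
  | prob (k : ℕ) (p : Fin k → ℝ) (tgt : Fin k → Loc L)
      (hp : ∀ i, p i ∈ Set.Ioo (0 : ℝ) 1) (hsum : ∑ i, p i = 1)
  | branch (k : ℕ) (φ : Fin k → PolyPred X) (tgt : Fin k → Loc L)
      (hφ : ∀ x : X → ℝ, ∃! i, (φ i).Sat x)
  | assign (f : (X → ℝ) → (R → ℝ) → (X → ℝ)) (hf : Measurable (Function.uncurry f))
      (tgt : Loc L)

/-- A control flow graph with nonterminal labels `L`, program variables `X` and sampling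
variables `R`, given by the outgoing transitions of each nonterminal label. -/
structure CFG (L X R : Type*) where
  block : L → Block L X R

/-- A bounded sampling variable: its distribution, and a nonempty bounded interval in which
its values lie with probability one. -/
structure SamplingVar where
  law : Measure ℝ
  isProb : IsProbabilityMeasure law
  supp : Set ℝ
  supp_nonempty : supp.Nonempty
  supp_interval : supp.OrdConnected
  supp_bounded : Bornology.IsBounded supp
  ae_mem_supp : ∀ᵐ t ∂law, t ∈ supp

instance (s : SamplingVar) : IsProbabilityMeasure s.law := s.isProb

variable {L X R : Type*}

/-- The joint distribution of the (independent) sampling variables. -/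
def sampleLaw [Fintype R] (D : R → SamplingVar) : Measure (R → ℝ) :=
  Measure.pi fun i => (D i).law

instance [Fintype R] (D : R → SamplingVar) : IsProbabilityMeasure (sampleLaw D) := by
  unfold sampleLaw; infer_instance

/-- The index of the only true guard of a branching label. -/
def trueGuard {k : ℕ} {φ : Fin k → PolyPred X} (hφ : ∀ x : X → ℝ, ∃! i, (φ i).Sat x)
    (x : X → ℝ) : Fin k :=
  (hφ x).exists.choose

/-! ### Paths, reachability and invariants -/

/-- `Step G D c c'`: the path `c, c'` is admissible, i.e. `c'` may follow `c` in a finite path. -/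
inductive Step (G : CFG L X R) (D : R → SamplingVar) : Config L X → Config L X → Prop
  | term (x : X → ℝ) : Step G D (.term, x) (.term, x)
  | demonic {ℓ : L} {T : Finset (Loc L)} {hT : T.Nonempty} (h : G.block ℓ = .demonic T hT)
      {ℓ' : Loc L} (hℓ' : ℓ' ∈ T) (x : X → ℝ) : Step G D (.lab ℓ, x) (ℓ', x)
  | prob {ℓ : L} {k : ℕ} {p : Fin k → ℝ} {tgt : Fin k → Loc L} {hp} {hsum}
      (h : G.block ℓ = .prob k p tgt hp hsum) (i : Fin k) (x : X → ℝ) :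
      Step G D (.lab ℓ, x) (tgt i, x)
  | branch {ℓ : L} {k : ℕ} {φ : Fin k → PolyPred X} {tgt : Fin k → Loc L} {hφ}
      (h : G.block ℓ = .branch k φ tgt hφ) (i : Fin k) (x : X → ℝ) (hx : (φ i).Sat x) :
      Step G D (.lab ℓ, x) (tgt i, x)
  | assign {ℓ : L} {f : (X → ℝ) → (R → ℝ) → (X → ℝ)} {hf} {tgt : Loc L}
      (h : G.block ℓ = .assign f hf tgt) (x : X → ℝ) (r : R → ℝ)
      (hr : ∀ i, r i ∈ (D i).supp) : Step G D (.lab ℓ, x) (tgt, f x r)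

/-- `c` is reachable from `c₀` along a finite path. -/
def Reachable (G : CFG L X R) (D : R → SamplingVar) (c₀ c : Config L X) : Prop :=
  Relation.ReflTransGen (Step G D) c₀ c

/-- `I` is a polynomial invariant for the initial configuration `c₀`. -/
def IsInvariant (G : CFG L X R) (D : R → SamplingVar) (c₀ : Config L X)
    (I : Loc L → PolyPred X) : Prop :=
  ∀ ℓ x, Reachable G D c₀ (ℓ, x) → (I ℓ).Sat x

/-! ### Schedulers and the probability measure on runs -/

/-- Finite sequences of configurations with time indices `0, …, n`. -/
abbrev History (L X : Type*) (n : ℕ) := (i : Finset.Iic n) → (fun _ : ℕ => Config L X) i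

/-- The configuration at the end of a history. -/
def History.last {n : ℕ} (h : History L X n) : Config L X :=
  h ⟨n, Finset.mem_Iic.2 le_rfl⟩

/-- A (measurable) scheduler: after every history that ends in a demonic label it selects one of
the transitions of this label, represented by its target. Its values after other histories are
irrelevant. -/
structure Scheduler (G : CFG L X R) where
  choice : (n : ℕ) → History L X n → Loc L
  measurable_choice : ∀ n, Measurable (choice n)
  choice_mem : ∀ (n : ℕ) (h : History L X n) (ℓ : L) (T : Finset (Loc L)) (hT : T.Nonempty),
    h.last.1 = .lab ℓ → G.block ℓ = .demonic T hT → choice n h ∈ T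

/-- The distribution of the next configuration when the block of the current label is given, the
current valuation is `x`, and `m` is the target selected by the scheduler. -/
def Block.next [Fintype R] (D : R → SamplingVar) (m : Loc L) (x : X → ℝ) :
    Block L X R → Measure (Config L X)
  | .demonic _ _ => Measure.dirac (m, x)
  | .prob _ p tgt _ _ => ∑ i, ENNReal.ofReal (p i) • Measure.dirac (tgt i, x)
  | .branch _ _ tgt hφ => Measure.dirac (tgt (trueGuard hφ x), x)
  | .assign f _ tgt => (sampleLaw D).map fun r => (tgt, f x r)

/-- The distribution of the next configuration when the current one is `(ℓ, x)` and `m` is the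
target selected by the scheduler. -/
def stepLaw [Fintype R] (G : CFG L X R) (D : R → SamplingVar) (m : Loc L) :
    Loc L → (X → ℝ) → Measure (Config L X)
  | .term, x => Measure.dirac (.term, x)
  | .lab ℓ, x => (G.block ℓ).next D m x

instance [Finite L] : Countable (Loc L) := by
  have e : Loc L ≃ Option L :=
    { toFun := fun | .term => none | .lab ℓ => some ℓ
      invFun := fun | none => .term | some ℓ => .lab ℓ
      left_inv := fun a => by cases a <;> rfl
      right_inv := fun a => by cases a <;> rfl }
  exact e.countable_iff.2 inferInstance

theorem measurableSet_sat [Finite X] (φ : PolyPred X) : MeasurableSet {x | φ.Sat x} := by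
  have hc : ∀ g : MvPolynomial X ℝ, Measurable fun x : X → ℝ => MvPolynomial.eval x g :=
    fun g => (MvPolynomial.continuous_eval g).measurable
  induction φ with
  | tru => exact MeasurableSet.univ
  | fls => exact MeasurableSet.empty
  | atom g₁ c g₂ =>
    cases c
    · exact measurableSet_lt (hc g₁) (hc g₂)
    · exact measurableSet_le (hc g₁) (hc g₂)
    · exact measurableSet_lt (hc g₂) (hc g₁)
    · exact measurableSet_le (hc g₂) (hc g₁)
  | neg φ ih => exact ih.compl
  | conj φ ψ ih₁ ih₂ => exact ih₁.inter ih₂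
  | disj φ ψ ih₁ ih₂ => exact ih₁.union ih₂

theorem trueGuard_eq_iff {k : ℕ} {φ : Fin k → PolyPred X}
    (hφ : ∀ x : X → ℝ, ∃! i, (φ i).Sat x) (x : X → ℝ) (i : Fin k) :
    trueGuard hφ x = i ↔ (φ i).Sat x := by
  have h : (φ (trueGuard hφ x)).Sat x := (hφ x).exists.choose_spec
  exact ⟨fun e => e ▸ h, fun hi => (hφ x).unique h hi⟩

theorem measurable_trueGuard [Finite X] {k : ℕ} {φ : Fin k → PolyPred X}
    (hφ : ∀ x : X → ℝ, ∃! i, (φ i).Sat x) : Measurable (trueGuard hφ) := by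
  refine measurable_to_countable' fun i => ?_
  have : trueGuard hφ ⁻¹' {i} = {x | (φ i).Sat x} := by
    ext x; simp [trueGuard_eq_iff]
  rw [this]
  exact measurableSet_sat _

theorem measurable_blockNext [Finite X] [Fintype R] (D : R → SamplingVar) (m : Loc L)
    (B : Block L X R) : Measurable fun x => B.next D m x := by
  cases B with
  | demonic T hT => exact Measure.measurable_dirac.comp (by fun_prop)
  | prob k p tgt hp hsum =>
    refine Measure.measurable_of_measurable_coe _ fun s hs => ?_
    simp only [Block.next, Measure.coe_finsetSum, Measure.coe_smul, Finset.sum_apply,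
      Pi.smul_apply, smul_eq_mul]
    refine Finset.measurable_sum _ fun i _ => Measurable.const_mul ?_ _
    exact (Measure.measurable_coe hs).comp (Measure.measurable_dirac.comp (by fun_prop))
  | branch k φ tgt hφ =>
    refine Measure.measurable_dirac.comp (Measurable.prodMk ?_ measurable_id)
    exact (measurable_of_countable tgt).comp (measurable_trueGuard hφ)
  | assign f hf tgt =>
    refine Measure.measurable_of_measurable_coe _ fun s hs => ?_
    have hF : Measurable fun q : (X → ℝ) × (R → ℝ) => ((tgt, f q.1 q.2) : Config L X) :=
      measurable_const.prodMk hf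
    have : ∀ x, (Block.assign f hf tgt : Block L X R).next D m x s =
        sampleLaw D (Prod.mk x ⁻¹' ((fun q : (X → ℝ) × (R → ℝ) =>
          ((tgt, f q.1 q.2) : Config L X)) ⁻¹' s)) := fun x =>
      Measure.map_apply (hF.comp measurable_prodMk_left) hs
    simp only [this]
    exact measurable_measure_prodMk_left (hF hs)

theorem isProbabilityMeasure_blockNext [Fintype R] (D : R → SamplingVar) (m : Loc L) (x : X → ℝ)
    (B : Block L X R) : IsProbabilityMeasure (B.next D m x) := by
  cases B with
  | demonic T hT => exact Measure.dirac.isProbabilityMeasure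
  | prob k p tgt hp hsum =>
    refine ⟨?_⟩
    simp only [Block.next, Measure.coe_finsetSum, Measure.coe_smul, Finset.sum_apply,
      Pi.smul_apply, smul_eq_mul, measure_univ, mul_one]
    rw [← ENNReal.ofReal_sum_of_nonneg fun i _ => (hp i).1.le, hsum, ENNReal.ofReal_one]
  | branch k φ tgt hφ => exact Measure.dirac.isProbabilityMeasure
  | assign f hf tgt =>
    exact Measure.isProbabilityMeasure_map
      (measurable_const.prodMk (hf.comp measurable_prodMk_left)).aemeasurable

theorem measurable_stepLaw [Finite L] [Finite X] [Fintype R] (G : CFG L X R)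
    (D : R → SamplingVar) :
    Measurable fun q : Loc L × Loc L × (X → ℝ) => stepLaw G D q.1 q.2.1 q.2.2 := by
  refine measurable_from_prod_countable_right fun m => ?_
  refine measurable_from_prod_countable_right fun ℓ => ?_
  cases ℓ with
  | term => exact Measure.measurable_dirac.comp (by fun_prop)
  | lab ℓ => exact measurable_blockNext D m _

theorem measurable_last {n : ℕ} : Measurable (History.last : History L X n → Config L X) :=
  measurable_pi_apply _

/-- The transition kernel of the program under the scheduler `σ` at time `n`. -/
def stepKernel [Finite L] [Finite X] [Fintype R] (G : CFG L X R) (D : R → SamplingVar)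
    (σ : Scheduler G) (n : ℕ) : Kernel (History L X n) (Config L X) where
  toFun h := stepLaw G D (σ.choice n h) h.last.1 h.last.2
  measurable' :=
    (measurable_stepLaw G D).comp ((σ.measurable_choice n).prodMk measurable_last)

instance [Finite L] [Finite X] [Fintype R] (G : CFG L X R) (D : R → SamplingVar)
    (σ : Scheduler G) (n : ℕ) : IsMarkovKernel (stepKernel G D σ n) := by
  refine ⟨fun h => ?_⟩
  change IsProbabilityMeasure (stepLaw G D (σ.choice n h) h.last.1 h.last.2)
  cases h.last.1 with
  | term => exact Measure.dirac.isProbabilityMeasure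
  | lab ℓ => exact isProbabilityMeasure_blockNext D _ _ _

/-- The probability measure on runs induced by the scheduler `σ` and the initial
configuration `c₀` (Ionescu-Tulcea). -/
def runMeasure [Finite L] [Finite X] [Fintype R] (G : CFG L X R) (D : R → SamplingVar)
    (c₀ : Config L X) (σ : Scheduler G) : Measure (ℕ → Config L X) :=
  Kernel.trajMeasure (X := fun _ => Config L X) (Measure.dirac c₀) (stepKernel G D σ)

/-- The termination time of a run; it is `⊤` if the run does not terminate. -/
def termTime (ω : ℕ → Config L X) : ℕ∞ :=
  ⨅ (n : ℕ) (_ : (ω n).1 = .term), (n : ℕ∞)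

/-- The probability under `σ` that the termination time exceeds `n`. -/
def probTermGT [Finite L] [Finite X] [Fintype R] (G : CFG L X R) (D : R → SamplingVar)
    (c₀ : Config L X) (σ : Scheduler G) (n : ℕ) : ℝ :=
  (runMeasure G D c₀ σ).real {ω | (n : ℕ∞) < termTime ω}

/-- `M` is a concentration bound: the probability that the termination time exceeds `N` decreases
exponentially for `N ≥ M`, uniformly in the scheduler. -/
def IsConcentrationBound [Finite L] [Finite X] [Fintype R] (G : CFG L X R)
    (D : R → SamplingVar) (c₀ : Config L X) (M : ℕ) : Prop :=
  ∃ c₁ c₂ : ℝ, 0 ≤ c₁ ∧ 0 < c₂ ∧ ∀ (σ : Scheduler G) (N : ℕ), M ≤ N →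
    probTermGT G D c₀ σ N ≤ c₁ * Real.exp (-c₂ * N)

/-! ### Polynomial ranking supermartingales -/

/-- The pre-expectation of `η`. -/
def preExp [Fintype R] (G : CFG L X R) (D : R → SamplingVar) (η : Loc L → (X → ℝ) → ℝ) :
    Loc L → (X → ℝ) → ℝ
  | .term, x => η .term x
  | .lab ℓ, x =>
    match G.block ℓ with
    | .demonic T hT => T.sup' hT fun ℓ' => η ℓ' x
    | .prob _ p tgt _ _ => ∑ i, p i * η (tgt i) x
    | .branch _ _ tgt hφ => η (tgt (trueGuard hφ x)) x
    | .assign f _ tgt => ∫ r, η tgt (f x r) ∂(sampleLaw D)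

/-- The predicate `TERM(ℓ)`: at a branching label, the disjunction of the guards of the
transitions with nonterminal target; `true` at all other labels. -/
def TermPred (G : CFG L X R) (ℓ : L) (x : X → ℝ) : Prop :=
  match G.block ℓ with
  | .branch _ φ tgt _ => ∃ i, tgt i ≠ .term ∧ (φ i).Sat x
  | _ => True

/-- `η` is a polynomial ranking supermartingale map of degree `d` with constants `ε` and `K`,
with respect to the program and the invariant `I`. -/
structure IsPRSM [Fintype R] (G : CFG L X R) (D : R → SamplingVar) (I : Loc L → PolyPred X)
    (d : ℕ) (η : Loc L → (X → ℝ) → ℝ) (ε K : ℝ) : Prop where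
  eps_pos : 0 < ε
  K_le : K ≤ -ε
  polynomial : ∀ ℓ, ∃ p : MvPolynomial X ℝ, p.totalDegree ≤ d ∧
    ∀ x, η ℓ x = MvPolynomial.eval x p
  nonneg : ∀ (ℓ : L) (x : X → ℝ), (I (.lab ℓ)).Sat x → 0 ≤ η (.lab ℓ) x
  terminal : ∀ x, η .term x = K
  decrease : ∀ (ℓ : L) (x : X → ℝ), (I (.lab ℓ)).Sat x → TermPred G ℓ x →
    preExp G D η (.lab ℓ) x ≤ η (.lab ℓ) x - ε

/-- `η` is difference-bounded with respect to the nonempty interval `[a, b]`. -/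
structure IsDifferenceBounded (G : CFG L X R) (D : R → SamplingVar) (I : Loc L → PolyPred X)
    (η : Loc L → (X → ℝ) → ℝ) (a b : ℝ) : Prop where
  le : a ≤ b
  demonic : ∀ (ℓ : L) T hT, G.block ℓ = .demonic T hT → ∀ ℓ' ∈ T, ∀ x,
    (I (.lab ℓ)).Sat x → η ℓ' x - η (.lab ℓ) x ∈ Set.Icc a b
  prob : ∀ (ℓ : L) k p tgt hp hsum, G.block ℓ = .prob k p tgt hp hsum → ∀ i x,
    (I (.lab ℓ)).Sat x → η (tgt i) x - η (.lab ℓ) x ∈ Set.Icc a b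
  branch : ∀ (ℓ : L) k φ tgt hφ, G.block ℓ = .branch k φ tgt hφ → ∀ i x,
    (I (.lab ℓ)).Sat x → (φ i).Sat x → η (tgt i) x - η (.lab ℓ) x ∈ Set.Icc a b
  assign : ∀ (ℓ : L) f hf tgt, G.block ℓ = .assign f hf tgt → ∀ x,
    (I (.lab ℓ)).Sat x → ∀ r : R → ℝ, (∀ i, r i ∈ (D i).supp) →
      η tgt (f x r) - η (.lab ℓ) x ∈ Set.Icc a b

end

end ProbProg

/- Write `X n` for the value of `η` at time `n`, and replace `exp (t * X n)` by `0` once the program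
has terminated. A transition out of a configuration satisfying `TERM` changes `η` by an amount in
`[a, b]` with mean at most `-ε`, so by Hoeffding's lemma it multiplies the expected exponential by
at most `exp (-t ε + t² (b - a)² / 8)`; any other transition leads to `⊥`, where the killed
exponential vanishes. As `η` is nonnegative before termination, Markov's inequality bounds
`ℙ (T > n)` by `exp (-t (ε n - X 0) + t² n (b - a)² / 8)` for every `t ≥ 0`. The tail bound is the
optimum over `t`; a small fixed `t` gives an exponential rate for all `n`. -/

namespace ProbProg

open MeasureTheory ProbabilityTheory Preorder Filter Set
open scoped ENNReal Topology

noncomputable section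

/-! ### Exponential bounds -/

section Chernoff

theorem mgf_le_exp_of_mem_Icc {Ω : Type*} [MeasurableSpace Ω] {μ : Measure Ω}
    [IsProbabilityMeasure μ] {Y : Ω → ℝ} {a b : ℝ} (hY : AEMeasurable Y μ)
    (hb : ∀ᵐ ω ∂μ, Y ω ∈ Icc a b) (t : ℝ) :
    mgf Y μ t ≤ Real.exp (t * μ[Y] + t ^ 2 * (b - a) ^ 2 / 8) := by
  have hvar : (((‖b - a‖₊ / 2) ^ 2 : NNReal) : ℝ) = (b - a) ^ 2 / 4 := by
    rw [NNReal.coe_pow, NNReal.coe_div, coe_nnnorm, Real.norm_eq_abs, div_pow, sq_abs]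
    norm_num
  calc mgf Y μ t = mgf (fun ω => Y ω - μ[Y] + μ[Y]) μ t := by simp only [sub_add_cancel]
    _ = mgf (fun ω => Y ω - μ[Y]) μ t * Real.exp (t * μ[Y]) := mgf_add_const _
    _ ≤ Real.exp ((b - a) ^ 2 / 4 * t ^ 2 / 2) * Real.exp (t * μ[Y]) := by
      gcongr
      exact hvar ▸ (hasSubgaussianMGF_of_mem_Icc hY hb).mgf_le t
    _ = Real.exp (t * μ[Y] + t ^ 2 * (b - a) ^ 2 / 8) := by
      rw [← Real.exp_add]
      ring_nf

theorem lintegral_exp_le_of_mem_Icc {Ω : Type*} [MeasurableSpace Ω] {μ : Measure Ω}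
    [IsProbabilityMeasure μ] {Y : Ω → ℝ} {a b m t : ℝ} (hY : AEMeasurable Y μ)
    (hb : ∀ᵐ ω ∂μ, Y ω ∈ Icc a b) (hm : μ[Y] ≤ m) (ht : 0 ≤ t) :
    ∫⁻ ω, ENNReal.ofReal (Real.exp (t * Y ω)) ∂μ ≤
      ENNReal.ofReal (Real.exp (t * m + t ^ 2 * (b - a) ^ 2 / 8)) := by
  rw [← ofReal_integral_eq_lintegral_ofReal (integrable_exp_mul_of_mem_Icc hY hb)
    (ae_of_all _ fun _ => (Real.exp_pos _).le)]
  refine ENNReal.ofReal_le_ofReal ((mgf_le_exp_of_mem_Icc hY hb t).trans ?_)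
  gcongr

theorem le_exp_neg_two_mul_sq_div {p s v : ℝ} (hs : 0 ≤ s) (hv : 0 ≤ v)
    (h : ∀ t, 0 ≤ t → p ≤ Real.exp (-(t * s) + t ^ 2 * v / 8)) :
    p ≤ Real.exp (-(2 * s ^ 2 / v)) := by
  -- For `v = 0` this choice is `t = 0`, which matches the junk value of the right-hand side.
  refine (h (4 * s / v) (by positivity)).trans_eq (congrArg Real.exp ?_)
  rcases hv.eq_or_lt with rfl | hv
  · simp only [div_zero, zero_mul, neg_zero, mul_zero, zero_div, add_zero]
  · field_simp
    ring

theorem nonpos_of_forall_le_exp_neg_mul {p s : ℝ} (hs : 0 < s)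
    (h : ∀ t, 0 ≤ t → p ≤ Real.exp (-(t * s))) : p ≤ 0 := by
  have hlim : Tendsto (fun t : ℝ => Real.exp (-(t * s))) atTop (𝓝 0) :=
    Real.tendsto_exp_neg_atTop_nhds_zero.comp (tendsto_id.atTop_mul_const hs)
  exact ge_of_tendsto hlim ((eventually_ge_atTop 0).mono h)

end Chernoff

/-! ### Trajectories of a sequence of kernels -/

section Trajectory

variable {E : ℕ → Type*} [∀ n, MeasurableSpace (E n)] {μ₀ : Measure (E 0)}
  {κ : (n : ℕ) → Kernel (Π i : Finset.Iic n, E i) (E (n + 1))} [∀ n, IsMarkovKernel (κ n)]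

theorem map_zero_trajMeasure : (Kernel.trajMeasure μ₀ κ).map (fun ω => ω 0) = μ₀ := by
  have h : (Kernel.trajMeasure μ₀ κ).map (frestrictLe 0) =
      μ₀.map (MeasurableEquiv.piUnique fun i : Finset.Iic 0 => E i).symm := by
    rw [Kernel.trajMeasure, Measure.map_comp _ _ (by fun_prop), Kernel.traj_map_frestrictLe,
      Kernel.partialTraj_self, Measure.id_comp]
    rfl
  calc (Kernel.trajMeasure μ₀ κ).map (fun ω => ω 0)
      = ((Kernel.trajMeasure μ₀ κ).map (frestrictLe 0)).map
          (MeasurableEquiv.piUnique fun i : Finset.Iic 0 => E i) := by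
        rw [Measure.map_map (by fun_prop) (by fun_prop)]
        rfl
    _ = μ₀ := by
        rw [h]
        exact MeasurableEquiv.map_map_symm _

theorem map_succ_trajMeasure [IsProbabilityMeasure μ₀] (n : ℕ) :
    (Kernel.trajMeasure μ₀ κ).map (fun ω => ω (n + 1)) =
      κ n ∘ₘ (Kernel.trajMeasure μ₀ κ).map (frestrictLe n) := by
  rw [← Measure.snd_compProd, Kernel.map_frestrictLe_trajMeasure_compProd_eq_map_trajMeasure,
    Measure.snd_map_prodMk (by fun_prop)]

end Trajectory

variable {L X R : Type*}

/-! ### One transition -/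

/-- The target `m` is a possible choice of a scheduler after a history that ends in the label `ℓ`;
this is a restriction only if `ℓ` is demonic. -/
def Admissible (G : CFG L X R) (ℓ m : Loc L) : Prop :=
  ∀ (ℓ' : L) (T : Finset (Loc L)) (hT : T.Nonempty),
    ℓ = .lab ℓ' → G.block ℓ' = .demonic T hT → m ∈ T

theorem admissible_choice {G : CFG L X R} (σ : Scheduler G) {n : ℕ} (h : History L X n) :
    Admissible G h.last.1 (σ.choice n h) :=
  σ.choice_mem n h

theorem measurableSet_forall_admissible [Finite L] {G : CFG L X R}
    {p : Loc L → Config L X → Prop} (hp : ∀ m, MeasurableSet {c | p m c}) :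
    MeasurableSet {c : Config L X | ∀ m, Admissible G c.1 m → p m c} :=
  measurableSet_setOfPred.2 <| .forall fun m =>
    ((measurable_of_countable (Admissible G · m)).comp measurable_fst).imp
      (measurableSet_setOfPred.1 (hp m))

theorem measurableSet_fst_eq_term : MeasurableSet {c : Config L X | c.1 = .term} :=
  measurable_fst (MeasurableSet.of_discrete (s := {Loc.term}))

section Transition

variable [Fintype R] {G : CFG L X R} {D : R → SamplingVar}

instance (m ℓ : Loc L) (x : X → ℝ) : IsProbabilityMeasure (stepLaw G D m ℓ x) := by
  cases ℓ with
  | term => exact Measure.dirac.isProbabilityMeasure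
  | lab ℓ => exact isProbabilityMeasure_blockNext D _ _ _

theorem stepLaw_lab_of_block_eq {ℓ : L} {B : Block L X R} (h : G.block ℓ = B) (m : Loc L)
    (x : X → ℝ) : stepLaw G D m (.lab ℓ) x = B.next D m x := by
  rw [stepLaw, h]

theorem ae_mem_supp_sampleLaw (D : R → SamplingVar) :
    ∀ᵐ r ∂(sampleLaw D), ∀ i, r i ∈ (D i).supp :=
  ae_all_iff.2 fun i =>
    (Measure.tendsto_eval_ae_ae (μ := fun i => (D i).law)).eventually (D i).ae_mem_supp

theorem ae_stepLaw_of_forall_step {m ℓ : Loc L} {x : X → ℝ} (hm : Admissible G ℓ m)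
    {p : Config L X → Prop} (hp : MeasurableSet {c | p c}) (h : ∀ c, Step G D (ℓ, x) c → p c) :
    ∀ᵐ c ∂(stepLaw G D m ℓ x), p c := by
  cases ℓ with
  | term => exact (ae_dirac_iff hp).2 (h _ (.term x))
  | lab ℓ =>
    cases hB : G.block ℓ <;> rw [stepLaw_lab_of_block_eq hB]
    case demonic T hT => exact (ae_dirac_iff hp).2 (h _ (.demonic hB (hm ℓ T hT rfl hB) x))
    case prob k q tgt hq hsum =>
      exact ae_finsetSum_measure_iff.2 fun i _ =>
        Measure.ae_smul_measure ((ae_dirac_iff hp).2 (h _ (.prob hB i x))) _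
    case branch k φ tgt hφ =>
      exact (ae_dirac_iff hp).2 (h _ (.branch hB _ x ((trueGuard_eq_iff hφ x _).1 rfl)))
    case assign f hf tgt =>
      refine (ae_map_iff (by fun_prop) hp).2 ?_
      filter_upwards [ae_mem_supp_sampleLaw D] with r hr
      exact h _ (.assign hB x r hr)

theorem ae_stepLaw_term_of_not_termPred {m : Loc L} {ℓ : L} {x : X → ℝ} (h : ¬ TermPred G ℓ x) :
    ∀ᵐ c ∂(stepLaw G D m (.lab ℓ) x), c.1 = .term := by
  unfold TermPred at h
  cases hB : G.block ℓ with
  | branch k φ tgt hφ =>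
    rw [stepLaw_lab_of_block_eq hB]
    simp only [hB, not_exists, not_and] at h
    refine (ae_dirac_iff measurableSet_fst_eq_term).2 ?_
    exact not_imp_comm.1 (h _) (not_not.2 ((trueGuard_eq_iff hφ x _).1 rfl))
  | _ => simp only [hB, not_true_eq_false] at h

theorem integral_stepLaw_le_preExp {η : Loc L → (X → ℝ) → ℝ}
    (hη : Measurable fun c : Config L X => η c.1 c.2) {m ℓ : Loc L} (hm : Admissible G ℓ m)
    (x : X → ℝ) : ∫ c, η c.1 c.2 ∂(stepLaw G D m ℓ x) ≤ preExp G D η ℓ x := by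
  have hdirac (c : Config L X) : ∫ c', η c'.1 c'.2 ∂(Measure.dirac c) = η c.1 c.2 :=
    integral_dirac' _ c hη.stronglyMeasurable
  cases ℓ with
  | term => exact (hdirac _).le
  | lab ℓ =>
    cases hB : G.block ℓ <;> rw [stepLaw_lab_of_block_eq hB] <;> simp only [preExp, hB, Block.next]
    case demonic T hT =>
      rw [hdirac]
      exact Finset.le_sup' (fun ℓ' => η ℓ' x) (hm ℓ T hT rfl hB)
    case prob k p tgt hp hsum =>
      rw [integral_finsetSum_measure fun i _ => (integrable_dirac' hη.stronglyMeasurable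
        enorm_lt_top).smul_measure ENNReal.ofReal_ne_top]
      refine (Finset.sum_congr rfl fun i _ => ?_).le
      rw [integral_smul_measure, hdirac, ENNReal.toReal_ofReal (hp i).1.le, smul_eq_mul]
    case branch k φ tgt hφ => exact (hdirac _).le
    case assign f hf tgt => exact (integral_map (by fun_prop) hη.aestronglyMeasurable).le

end Transition

/-! ### Runs -/

theorem ne_term_of_lt_termTime {ω : ℕ → Config L X} {n : ℕ} (h : (n : ℕ∞) < termTime ω) :
    (ω n).1 ≠ .term :=
  fun hn => (iInf₂_le (f := fun (k : ℕ) (_ : (ω k).1 = .term) => (k : ℕ∞)) n hn).not_gt h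

section Run

variable [Finite L] [Finite X] [Fintype R] {G : CFG L X R} {D : R → SamplingVar}
  {c₀ : Config L X} (σ : Scheduler G)

instance : IsProbabilityMeasure (runMeasure G D c₀ σ) := by
  unfold runMeasure
  infer_instance

theorem ae_runMeasure_zero : ∀ᵐ ω ∂(runMeasure G D c₀ σ), ω 0 = c₀ := by
  have h : ∀ᵐ c ∂((runMeasure G D c₀ σ).map fun ω => ω 0), c = c₀ := by
    rw [runMeasure, map_zero_trajMeasure (E := fun _ => Config L X)]
    exact (ae_dirac_iff (measurableSet_singleton c₀)).2 rfl
  exact ae_of_ae_map (measurable_pi_apply 0).aemeasurable h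

theorem ae_runMeasure_succ {p : Config L X → Prop} {n : ℕ} (hp : MeasurableSet {c | p c})
    (h : ∀ᵐ ω ∂(runMeasure G D c₀ σ), ∀ᵐ c ∂(stepKernel G D σ n (frestrictLe n ω)), p c) :
    ∀ᵐ ω ∂(runMeasure G D c₀ σ), p (ω (n + 1)) := by
  have h' : ∀ᵐ c ∂((runMeasure G D c₀ σ).map fun ω => ω (n + 1)), p c := by
    rw [runMeasure, map_succ_trajMeasure (E := fun _ => Config L X)]
    refine Measure.ae_comp_of_ae_ae hp ((ae_map_iff (by fun_prop) ?_).2 h)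
    exact Kernel.measurable_coe _ hp.compl (measurableSet_singleton 0)
  exact ae_of_ae_map (measurable_pi_apply (n + 1)).aemeasurable h'

theorem lintegral_runMeasure_succ {g : Config L X → ℝ≥0∞} (hg : Measurable g) (n : ℕ) :
    ∫⁻ ω, g (ω (n + 1)) ∂(runMeasure G D c₀ σ) =
      ∫⁻ ω, ∫⁻ c, g c ∂(stepKernel G D σ n (frestrictLe n ω)) ∂(runMeasure G D c₀ σ) := by
  rw [← lintegral_map (μ := runMeasure G D c₀ σ) hg (measurable_pi_apply (n + 1)), runMeasure,
    map_succ_trajMeasure (E := fun _ => Config L X),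
    Measure.lintegral_bind (Kernel.aemeasurable _) hg.aemeasurable,
    lintegral_map hg.lintegral_kernel (by fun_prop)]

theorem measurable_stepLaw_config (G : CFG L X R) (D : R → SamplingVar) (m : Loc L) :
    Measurable fun c : Config L X => stepLaw G D m c.1 c.2 :=
  (measurable_stepLaw G D).comp (measurable_const.prodMk measurable_id)

theorem ae_runMeasure_of_reachable {p : Config L X → Prop} (hp : MeasurableSet {c | p c})
    (h : ∀ c, Reachable G D c₀ c → p c) (n : ℕ) : ∀ᵐ ω ∂(runMeasure G D c₀ σ), p (ω n) := by
  -- The reachable set need not be measurable, so the induction runs over all measurable `p`.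
  induction n generalizing p with
  | zero =>
    filter_upwards [ae_runMeasure_zero σ] with ω hω
    exact hω ▸ h _ .refl
  | succ n ih =>
    have hnext : MeasurableSet {c : Config L X |
        ∀ m, Admissible G c.1 m → ∀ᵐ c' ∂(stepLaw G D m c.1 c.2), p c'} :=
      measurableSet_forall_admissible fun m =>
        (Measure.measurable_coe hp.compl).comp (measurable_stepLaw_config G D m)
          (measurableSet_singleton 0)
    refine ae_runMeasure_succ σ hp ?_
    filter_upwards [ih hnext fun c hc m hm => ae_stepLaw_of_forall_step hm hp
      fun c' hc' => h c' (hc.tail hc')] with ω hω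
    exact hω _ (admissible_choice σ (frestrictLe n ω))

theorem lintegral_runMeasure_le_pow_mul {g : Config L X → ℝ≥0∞} (hg : Measurable g) {ρ : ℝ≥0∞}
    (h : ∀ c, Reachable G D c₀ c → ∀ m, Admissible G c.1 m →
      ∫⁻ c', g c' ∂(stepLaw G D m c.1 c.2) ≤ ρ * g c) (n : ℕ) :
    ∫⁻ ω, g (ω n) ∂(runMeasure G D c₀ σ) ≤ ρ ^ n * g c₀ := by
  induction n with
  | zero =>
    rw [lintegral_congr_ae ((ae_runMeasure_zero σ).mono fun ω hω => congrArg g hω),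
      lintegral_const, measure_univ, mul_one, pow_zero, one_mul]
  | succ n ih =>
    have hdrift : MeasurableSet {c : Config L X | ∀ m, Admissible G c.1 m →
        ∫⁻ c', g c' ∂(stepLaw G D m c.1 c.2) ≤ ρ * g c} :=
      measurableSet_forall_admissible fun m => measurableSet_le
        ((Measure.measurable_lintegral hg).comp (measurable_stepLaw_config G D m))
        (hg.const_mul ρ)
    calc ∫⁻ ω, g (ω (n + 1)) ∂(runMeasure G D c₀ σ)
        = ∫⁻ ω, ∫⁻ c, g c ∂(stepKernel G D σ n (frestrictLe n ω)) ∂(runMeasure G D c₀ σ) :=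
          lintegral_runMeasure_succ σ hg n
      _ ≤ ∫⁻ ω, ρ * g (ω n) ∂(runMeasure G D c₀ σ) := by
          refine lintegral_mono_ae ?_
          filter_upwards [ae_runMeasure_of_reachable σ hdrift h n] with ω hω
          exact hω _ (admissible_choice σ (frestrictLe n ω))
      _ = ρ * ∫⁻ ω, g (ω n) ∂(runMeasure G D c₀ σ) := lintegral_const_mul _ (by fun_prop)
      _ ≤ ρ ^ (n + 1) * g c₀ := by
          rw [pow_succ', mul_assoc]
          gcongr

theorem probTermGT_antitone : Antitone (probTermGT G D c₀ σ) := fun _ _ hmn =>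
  measureReal_mono fun ω (hω : _ < termTime ω) => (Nat.cast_le.2 hmn).trans_lt hω

end Run

/-! ### Ranking maps -/

/-- A difference-bounded ranking supermartingale map for the runs from `c₀`: the conditions of
`IsPRSM` and `IsDifferenceBounded`, with measurability in place of polynomiality, with reachability
in place of an invariant, and without a condition on the values at `⊥`. -/
structure IsRankingMap [Fintype R] (G : CFG L X R) (D : R → SamplingVar) (c₀ : Config L X)
    (η : Loc L → (X → ℝ) → ℝ) (ε a b : ℝ) : Prop where
  eps_pos : 0 < ε
  measurable : ∀ ℓ, Measurable (η ℓ)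
  nonneg : ∀ (ℓ : L) (x : X → ℝ), Reachable G D c₀ (.lab ℓ, x) → 0 ≤ η (.lab ℓ) x
  decrease : ∀ (ℓ : L) (x : X → ℝ), Reachable G D c₀ (.lab ℓ, x) → TermPred G ℓ x →
    preExp G D η (.lab ℓ) x ≤ η (.lab ℓ) x - ε
  sub_mem_Icc : ∀ (ℓ : L) (x : X → ℝ), Reachable G D c₀ (.lab ℓ, x) →
    ∀ c, Step G D (.lab ℓ, x) c → η c.1 c.2 - η (.lab ℓ) x ∈ Icc a b

theorem IsDifferenceBounded.sub_mem_Icc {G : CFG L X R} {D : R → SamplingVar}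
    {I : Loc L → PolyPred X} {η : Loc L → (X → ℝ) → ℝ} {a b : ℝ}
    (hab : IsDifferenceBounded G D I η a b) {ℓ : L} {x : X → ℝ} (hx : (I (.lab ℓ)).Sat x)
    {c : Config L X} (hc : Step G D (.lab ℓ, x) c) :
    η c.1 c.2 - η (.lab ℓ) x ∈ Icc a b := by
  cases hc with
  | demonic h hℓ' => exact hab.demonic _ _ _ h _ hℓ' _ hx
  | prob h i => exact hab.prob _ _ _ _ _ _ h i _ hx
  | branch h i _ hi => exact hab.branch _ _ _ _ _ h i _ hx hi
  | assign h _ r hr => exact hab.assign _ _ _ _ h _ hx r hr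

theorem IsPRSM.isRankingMap [Finite X] [Fintype R] {G : CFG L X R} {D : R → SamplingVar}
    {c₀ : Config L X} {I : Loc L → PolyPred X} {d : ℕ} {η : Loc L → (X → ℝ) → ℝ} {ε K a b : ℝ}
    (hη : IsPRSM G D I d η ε K) (hI : IsInvariant G D c₀ I)
    (hab : IsDifferenceBounded G D I η a b) : IsRankingMap G D c₀ η ε a b where
  eps_pos := hη.eps_pos
  measurable ℓ := by
    obtain ⟨p, -, hp⟩ := hη.polynomial ℓ
    exact (funext hp ▸ MvPolynomial.continuous_eval p).measurable
  nonneg ℓ x h := hη.nonneg ℓ x (hI _ _ h)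
  decrease ℓ x h := hη.decrease ℓ x (hI _ _ h)
  sub_mem_Icc _ _ h _ hc := hab.sub_mem_Icc (hI _ _ h) hc

/-- The exponential of `t * η`, killed at termination: it is `0` on terminal configurations. -/
def killedExp (η : Loc L → (X → ℝ) → ℝ) (t : ℝ) : Config L X → ℝ≥0∞ :=
  {c | c.1 ≠ .term}.indicator fun c => ENNReal.ofReal (Real.exp (t * η c.1 c.2))

theorem measurable_killedExp {η : Loc L → (X → ℝ) → ℝ}
    (hη : Measurable fun c : Config L X => η c.1 c.2) (t : ℝ) : Measurable (killedExp η t) :=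
  .indicator (by fun_prop) measurableSet_fst_eq_term.compl

theorem killedExp_le (η : Loc L → (X → ℝ) → ℝ) (t : ℝ) (c : Config L X) :
    killedExp η t c ≤ ENNReal.ofReal (Real.exp (t * η c.1 c.2)) :=
  indicator_le_self _ _ c

theorem killedExp_lab (η : Loc L → (X → ℝ) → ℝ) (t : ℝ) (ℓ : L) (x : X → ℝ) :
    killedExp η t (.lab ℓ, x) = ENNReal.ofReal (Real.exp (t * η (.lab ℓ) x)) :=
  indicator_of_mem (s := {c : Config L X | c.1 ≠ .term}) (by simp) _

namespace IsRankingMap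

variable [Finite L] [Fintype R] {G : CFG L X R} {D : R → SamplingVar} {c₀ : Config L X}
  {η : Loc L → (X → ℝ) → ℝ} {ε a b t : ℝ}

theorem measurable_prod (hη : IsRankingMap G D c₀ η ε a b) :
    Measurable fun c : Config L X => η c.1 c.2 :=
  measurable_from_prod_countable_right hη.measurable

theorem ae_sub_mem_Icc (hη : IsRankingMap G D c₀ η ε a b) {ℓ : L} {x : X → ℝ}
    (hx : Reachable G D c₀ (.lab ℓ, x)) {m : Loc L} (hm : Admissible G (.lab ℓ) m) :
    ∀ᵐ c ∂(stepLaw G D m (.lab ℓ) x), η c.1 c.2 - η (.lab ℓ) x ∈ Icc a b :=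
  ae_stepLaw_of_forall_step hm ((hη.measurable_prod.sub_const _) measurableSet_Icc)
    (hη.sub_mem_Icc ℓ x hx)

theorem integral_sub_le (hη : IsRankingMap G D c₀ η ε a b) {ℓ : L} {x : X → ℝ}
    (hx : Reachable G D c₀ (.lab ℓ, x)) (hT : TermPred G ℓ x) {m : Loc L}
    (hm : Admissible G (.lab ℓ) m) :
    ∫ c, (η c.1 c.2 - η (.lab ℓ) x) ∂(stepLaw G D m (.lab ℓ) x) ≤ -ε := by
  have hint : Integrable (fun c : Config L X => η c.1 c.2) (stepLaw G D m (.lab ℓ) x) :=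
    (integrable_add_const_iff (c := -η (.lab ℓ) x)).1 <| Integrable.of_mem_Icc a b
      (hη.measurable_prod.sub_const _).aemeasurable (hη.ae_sub_mem_Icc hx hm)
  rw [integral_sub hint (integrable_const _), integral_const, probReal_univ, one_smul]
  linarith [integral_stepLaw_le_preExp (D := D) hη.measurable_prod hm x, hη.decrease ℓ x hx hT]

theorem lintegral_killedExp_le_of_termPred (hη : IsRankingMap G D c₀ η ε a b) (ht : 0 ≤ t) {ℓ : L}
    {x : X → ℝ} (hx : Reachable G D c₀ (.lab ℓ, x)) (hT : TermPred G ℓ x) {m : Loc L}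
    (hm : Admissible G (.lab ℓ) m) :
    ∫⁻ c, killedExp η t c ∂(stepLaw G D m (.lab ℓ) x) ≤
      ENNReal.ofReal (Real.exp (t * -ε + t ^ 2 * (b - a) ^ 2 / 8)) *
        killedExp η t (.lab ℓ, x) := by
  have hY : Measurable fun c : Config L X => η c.1 c.2 - η (.lab ℓ) x :=
    hη.measurable_prod.sub_const _
  have hfactor (c : Config L X) : ENNReal.ofReal (Real.exp (t * η c.1 c.2)) =
      ENNReal.ofReal (Real.exp (t * (η c.1 c.2 - η (.lab ℓ) x))) * killedExp η t (.lab ℓ, x) := by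
    rw [killedExp_lab, ← ENNReal.ofReal_mul (Real.exp_pos _).le, ← Real.exp_add, ← mul_add,
      sub_add_cancel]
  calc ∫⁻ c, killedExp η t c ∂(stepLaw G D m (.lab ℓ) x)
      ≤ ∫⁻ c, ENNReal.ofReal (Real.exp (t * (η c.1 c.2 - η (.lab ℓ) x))) *
          killedExp η t (.lab ℓ, x) ∂(stepLaw G D m (.lab ℓ) x) :=
        lintegral_mono fun c => (killedExp_le η t c).trans_eq (hfactor c)
    _ = (∫⁻ c, ENNReal.ofReal (Real.exp (t * (η c.1 c.2 - η (.lab ℓ) x)))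
          ∂(stepLaw G D m (.lab ℓ) x)) * killedExp η t (.lab ℓ, x) :=
        lintegral_mul_const _ (by fun_prop)
    _ ≤ _ := by
        gcongr
        exact lintegral_exp_le_of_mem_Icc hY.aemeasurable (hη.ae_sub_mem_Icc hx hm)
          (hη.integral_sub_le hx hT hm) ht

theorem lintegral_killedExp_le (hη : IsRankingMap G D c₀ η ε a b) (ht : 0 ≤ t) {c : Config L X}
    (hc : Reachable G D c₀ c) {m : Loc L} (hm : Admissible G c.1 m) :
    ∫⁻ c', killedExp η t c' ∂(stepLaw G D m c.1 c.2) ≤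
      ENNReal.ofReal (Real.exp (t * -ε + t ^ 2 * (b - a) ^ 2 / 8)) * killedExp η t c := by
  have of_ae_term (h : ∀ᵐ c' ∂(stepLaw G D m c.1 c.2), c'.1 = .term) :
      ∫⁻ c', killedExp η t c' ∂(stepLaw G D m c.1 c.2) = 0 := by
    refine (lintegral_congr_ae (h.mono fun c' hc' => ?_)).trans lintegral_zero
    exact indicator_of_notMem (not_not.2 hc') _
  obtain ⟨_ | ℓ, x⟩ := c
  · refine (of_ae_term ?_).trans_le zero_le
    exact (ae_dirac_iff measurableSet_fst_eq_term).2 rfl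
  · by_cases hT : TermPred G ℓ x
    · exact hη.lintegral_killedExp_le_of_termPred ht hc hT hm
    · exact (of_ae_term (ae_stepLaw_term_of_not_termPred hT)).trans_le zero_le

variable [Finite X]

theorem ae_one_le_killedExp (hη : IsRankingMap G D c₀ η ε a b) (ht : 0 ≤ t) (σ : Scheduler G)
    (n : ℕ) : ∀ᵐ ω ∂(runMeasure G D c₀ σ), (n : ℕ∞) < termTime ω → 1 ≤ killedExp η t (ω n) := by
  have hlive : MeasurableSet {c : Config L X | c.1 ≠ .term → 1 ≤ killedExp η t c} :=
    measurableSet_fst_eq_term.compl.himp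
      (measurableSet_le measurable_const (measurable_killedExp hη.measurable_prod t))
  have hreach (c : Config L X) (hc : Reachable G D c₀ c) (hne : c.1 ≠ .term) :
      1 ≤ killedExp η t c := by
    obtain ⟨_ | ℓ, x⟩ := c
    · exact absurd rfl hne
    · rw [killedExp_lab, ENNReal.one_le_ofReal, Real.one_le_exp_iff]
      exact mul_nonneg ht (hη.nonneg ℓ x hc)
  filter_upwards [ae_runMeasure_of_reachable σ hlive hreach n] with ω hω hlt
  exact hω (ne_term_of_lt_termTime hlt)

theorem probTermGT_le_exp (hη : IsRankingMap G D c₀ η ε a b) (ht : 0 ≤ t) (σ : Scheduler G)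
    (n : ℕ) : probTermGT G D c₀ σ n ≤
      Real.exp (-(t * (ε * n - η c₀.1 c₀.2)) + t ^ 2 * (n * (b - a) ^ 2) / 8) := by
  have hmeas := measurable_killedExp hη.measurable_prod t
  refine ENNReal.toReal_le_of_le_ofReal (Real.exp_pos _).le ?_
  calc runMeasure G D c₀ σ {ω | (n : ℕ∞) < termTime ω}
      ≤ runMeasure G D c₀ σ {ω | 1 ≤ killedExp η t (ω n)} :=
        measure_mono_ae (hη.ae_one_le_killedExp ht σ n)
    _ ≤ ∫⁻ ω, killedExp η t (ω n) ∂(runMeasure G D c₀ σ) := by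
        simpa only [one_mul, Function.comp_def] using mul_meas_ge_le_lintegral
          (μ := runMeasure G D c₀ σ) (hmeas.comp (measurable_pi_apply n)) 1
    _ ≤ ENNReal.ofReal (Real.exp (t * -ε + t ^ 2 * (b - a) ^ 2 / 8)) ^ n * killedExp η t c₀ :=
        lintegral_runMeasure_le_pow_mul σ hmeas
          (fun _ hc _ hm => hη.lintegral_killedExp_le ht hc hm) n
    _ ≤ ENNReal.ofReal (Real.exp (t * -ε + t ^ 2 * (b - a) ^ 2 / 8)) ^ n *
          ENNReal.ofReal (Real.exp (t * η c₀.1 c₀.2)) := by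
        gcongr
        exact killedExp_le η t c₀
    _ = ENNReal.ofReal
          (Real.exp (-(t * (ε * n - η c₀.1 c₀.2)) + t ^ 2 * (n * (b - a) ^ 2) / 8)) := by
        rw [← ENNReal.ofReal_pow (Real.exp_pos _).le, ← ENNReal.ofReal_mul (by positivity),
          ← Real.exp_nat_mul, ← Real.exp_add]
        ring_nf

theorem probTermGT_le_exp_neg_two_mul_sq_div (hη : IsRankingMap G D c₀ η ε a b) (σ : Scheduler G)
    {n : ℕ} (hn : η c₀.1 c₀.2 ≤ ε * n) : probTermGT G D c₀ σ n ≤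
      Real.exp (-(2 * (ε * n - η c₀.1 c₀.2) ^ 2 / (n * (b - a) ^ 2))) :=
  le_exp_neg_two_mul_sq_div (sub_nonneg.2 hn) (by positivity)
    fun _ ht => hη.probTermGT_le_exp ht σ n

theorem probTermGT_eq_zero (hη : IsRankingMap G D c₀ η ε a b) (σ : Scheduler G) {n : ℕ}
    (hn : η c₀.1 c₀.2 < ε * n) (hv : (n : ℝ) * (b - a) ^ 2 = 0) :
    probTermGT G D c₀ σ n = 0 := by
  refine le_antisymm (nonpos_of_forall_le_exp_neg_mul (sub_pos.2 hn) fun t ht => ?_)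
    measureReal_nonneg
  simpa only [hv, mul_zero, zero_div, add_zero] using hη.probTermGT_le_exp ht σ n

theorem isConcentrationBound (hη : IsRankingMap G D c₀ η ε a b) (M : ℕ) :
    IsConcentrationBound G D c₀ M := by
  have hε := hη.eps_pos
  -- With this `t` the quadratic term of the exponent is at most half of the linear term.
  set t : ℝ := 4 * ε / ((b - a) ^ 2 + 1)
  have ht : 0 < t := by positivity
  have hquad : t * (b - a) ^ 2 ≤ 4 * ε := by
    have : t * ((b - a) ^ 2 + 1) = 4 * ε := div_mul_cancel₀ _ (by positivity)
    linarith
  refine ⟨Real.exp (t * η c₀.1 c₀.2), t * ε / 2, (Real.exp_pos _).le, by positivity,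
    fun σ N _ => (hη.probTermGT_le_exp ht.le σ N).trans ?_⟩
  rw [← Real.exp_add, Real.exp_le_exp]
  have : (N : ℝ) * t * (t * (b - a) ^ 2) ≤ N * t * (4 * ε) := by gcongr
  linarith

end IsRankingMap

end

end ProbProg

theorem theorem2_general {L X R : Type*} [Finite L] [Finite X] [Fintype R]
    {G : ProbProg.CFG L X R} {D : R → ProbProg.SamplingVar} {c₀ : ProbProg.Config L X}
    {η : ProbProg.Loc L → (X → ℝ) → ℝ} {ε a b : ℝ}
    (hη : ProbProg.IsRankingMap G D c₀ η ε a b) :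
    (∀ (σ : ProbProg.Scheduler G) (n : ℕ), η c₀.1 c₀.2 < ε * n →
      ProbProg.probTermGT G D c₀ σ n ≤
        Real.exp (-(2 * (ε * n - η c₀.1 c₀.2) ^ 2 / (n * (b - a) ^ 2))) ∧
      ((n : ℝ) * (b - a) ^ 2 = 0 → ProbProg.probTermGT G D c₀ σ n = 0)) ∧
    ∀ M : ℕ, ProbProg.IsConcentrationBound G D c₀ M :=
  ⟨fun σ _ hn => ⟨hη.probTermGT_le_exp_neg_two_mul_sq_div σ hn.le, hη.probTermGT_eq_zero σ hn⟩,
    hη.isConcentrationBound⟩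

theorem theorem2 {L X R : Type*} [Finite L] [Finite X] [Fintype R]
    (G : ProbProg.CFG L X R) (D : R → ProbProg.SamplingVar)
    (ℓ₀ : ProbProg.Loc L) (x₀ : X → ℝ)
    (I : ProbProg.Loc L → ProbProg.PolyPred X) (hI : ProbProg.IsInvariant G D (ℓ₀, x₀) I)
    (d : ℕ) (η : ProbProg.Loc L → (X → ℝ) → ℝ) (ε K a b : ℝ)
    (hη : ProbProg.IsPRSM G D I d η ε K)
    (hab : ProbProg.IsDifferenceBounded G D I η a b) :
    (∀ (σ : ProbProg.Scheduler G) (n : ℕ), 1 ≤ n → ε * ((n : ℝ) - 1) > η ℓ₀ x₀ →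
      ProbProg.probTermGT G D (ℓ₀, x₀) σ n ≤
        Real.exp (-(2 * (ε * ((n : ℝ) - 1) - η ℓ₀ x₀) ^ 2 / (((n : ℝ) - 1) * (b - a) ^ 2))) ∧
      -- if the denominator vanishes, the bound reads `exp (-∞) = 0`
      (((n : ℝ) - 1) * (b - a) ^ 2 = 0 → ProbProg.probTermGT G D (ℓ₀, x₀) σ n = 0)) ∧
    ∀ M : ℕ, η ℓ₀ x₀ / ε + 2 ≤ M → ProbProg.IsConcentrationBound G D (ℓ₀, x₀) M := by
  obtain ⟨htail, hconc⟩ := theorem2_general (hη.isRankingMap hI hab)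
  refine ⟨fun σ n hn hlt => ?_, fun M _ => hconc M⟩
  have hanti := ProbProg.probTermGT_antitone (D := D) (c₀ := (ℓ₀, x₀)) σ (Nat.sub_le n 1)
  rw [← Nat.cast_pred hn] at hlt ⊢
  exact (htail σ (n - 1) hlt).imp hanti.trans fun hzero hv =>
    (hanti.trans_eq (hzero hv)).antisymm MeasureTheory.measureReal_nonneg
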